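/- Let $\mathbb{N}_+=\{1,2,3,\dots\}$ and let $w=(w_1,w_2)\in\mathbb{N}_+^2$. For a nonzero polynomial $h=\sum_{i,j}c_{ij}x^iy^j\in\mathbb{C}[x,y]$ put $\deg_w h=\max\{iw_1+jw_2 : c_{ij}\neq 0\}$. A polynomial automorphism of $\mathbb{C}^2$ is a polynomial map $F=(F_1,F_2):\mathbb{C}^2\to\mathbb{C}^2$ that has a two-sided inverse which is also a polynomial map; let $\mathrm{Aut}(\mathbb{C}^2)$ be the set of all of them. Put $\tilde w=\max\{w_1,w_2\}$ and $\underline{w}=\min\{w_1,w_2\}$, and for $m\in\mathbb{N}_+$ let $m\mathbb{N}_+=\{km : k\in\mathbb{N}_+\}$ and $$Z_m=\bigl\{(d_1,d_2)\in(m\mathbb{N}_+)^2 : (d_1\mid d_2\text{ or }d_2\mid d_1),\ \max\{d_1,d_2\}\ge\tilde w,\text{ and } (\min\{d_1,d_2\}<\tilde w\Rightarrow\min\{d_1,d_2\}=\underline{w})\bigr\}.$$ Then $$\{(\deg_w F_1,\deg_w F_2) : (F_1,F_2)\in\mathrm{Aut}(\mathbb{C}^2)\}=Z_{w_1}\cup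 Z_{w_2}\cup\{(w_1,w_2),(w_2,w_1),(\tilde w,\tilde w)\}.$$ -/

import Mathlib

/-- A polynomial map `F = (F 0, …, F (n-1)) : ℂⁿ → ℂⁿ`, given by its component polynomials. -/
abbrev PolyMap (n : ℕ) : Type := Fin n → MvPolynomial (Fin n) ℂ

namespace PolyMap

/-- The composition `F ∘ G`: substitute the components of `G` for the variables in `F`. -/
noncomputable def comp {n : ℕ} (F G : PolyMap n) : PolyMap n :=
  fun i => MvPolynomial.bind₁ G (F i)

/-- The identity map `(x₁, …, xₙ)`. -/
noncomputable def identity (n : ℕ) : PolyMap n := fun i => MvPolynomial.X i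

/-- `F` is a polynomial automorphism of `ℂⁿ`: it has a two-sided polynomial inverse. -/
def IsAutomorphism {n : ℕ} (F : PolyMap n) : Prop :=
  ∃ G : PolyMap n, F.comp G = identity n ∧ G.comp F = identity n

/-- The set `Aut(ℂⁿ)` of polynomial automorphisms of `ℂⁿ`. -/
def aut (n : ℕ) : Set (PolyMap n) := {F | F.IsAutomorphism}

/-- The weighted bidegree `(deg_w F₁, deg_w F₂)` with respect to the weight `w = (w₁, w₂)`. -/
noncomputable def weightedBidegree (w : ℕ × ℕ) (F : PolyMap 2) : ℕ × ℕ :=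
  (MvPolynomial.weightedTotalDegree ![w.1, w.2] (F 0),
    MvPolynomial.weightedTotalDegree ![w.1, w.2] (F 1))

end PolyMap

/-- The set `m ℕ₊` of positive multiples of `m`. -/
def positiveMultiples (m : ℕ) : Set ℕ := {d | ∃ k : ℕ, 0 < k ∧ d = k * m}

/-! For an automorphism $F$ the Jacobian is a nonzero constant, so $g\mapsto\mathrm{Jac}(F_i,g)$ is
a multiple of a partial derivative transported by $F$, hence locally nilpotent. This passes to
weighted leading forms $T$ of $F_i$. Kernels of locally nilpotent derivations are factorially
closed, so if $T$ vanishes on one axis it depends on one variable only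
(`pderiv_eq_zero_of_axis_eq_zero`).

If both leading forms are nonzero on a common axis $j$, the degrees are multiples $k w_j$, $l w_j$,
with $k,l$ the degrees of $F_1,F_2$ restricted to that axis. They are also the degrees of one
component of $F^{-1}$ on the two axes (`natDegree_axis_inverse`), and for a single component one of
these divides the other (`dvd_or_dvd_natDegree_axis`). Otherwise the leading forms involve different
variables, so their Jacobian is nonzero and the degrees add up to $w_1+w_2$. The bounds by $\max
w_i$ hold because a component of degree below $w_j$ is free of $x_j$.

Conversely, swaps and at most two elementary maps realise all listed pairs. -/

/-! ### Locally nilpotent derivations and their degree function -/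

/-- A derivation is locally nilpotent if each element is killed by some iterate of it. -/
def Derivation.IsLocallyNilpotent {k R : Type*} [CommRing k] [CommRing R] [Algebra k R]
    (D : Derivation k R R) : Prop :=
  ∀ u, ∃ n : ℕ, D^[n] u = 0

namespace Derivation

variable {k R : Type*} [CommRing k] [CommRing R] [Algebra k R] (D : Derivation k R R)

theorem iterate_mul_of_apply_eq_zero {u : R} (hu : D u = 0) (v : R) (n : ℕ) :
    D^[n] (u * v) = u * D^[n] v := by
  induction n with
  | zero => rfl
  | succ n ih => simp [Function.iterate_succ_apply', ih, hu]

/-- In the Leibniz expansion of order $n+m$ every other term applies $D$ too often to `u` or to `v`.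
Over a domain of characteristic zero this makes the nilpotency order additive on products, like a
degree. -/
theorem iterate_add_mul {n m : ℕ} {u v : R} (hu : D^[n + 1] u = 0) (hv : D^[m + 1] v = 0) :
    D^[n + m] (u * v) = (n + m).choose n * (D^[n] u * D^[m] v) := by
  induction hs : n + m using Nat.strong_induction_on generalizing n m u v with
  | _ s ih =>
  subst hs
  rcases n with _ | n
  · simp [D.iterate_mul_of_apply_eq_zero (by simpa using hu)]
  rcases m with _ | m
  · rw [mul_comm u, Nat.add_zero, D.iterate_mul_of_apply_eq_zero (by simpa using hv)]
    simp [mul_comm]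
  have h1 := ih (n + 1 + m) (by omega) (u := u) (v := D v) hu
    (by rwa [← Function.iterate_succ_apply]) rfl
  have h2 := ih (n + (m + 1)) (by omega) (u := D u) (v := v)
    (by rwa [← Function.iterate_succ_apply]) hv rfl
  rw [show n + 1 + (m + 1) = (n + m + 1) + 1 by ring, Function.iterate_succ_apply, D.leibniz,
    iterate_map_add, smul_eq_mul, smul_eq_mul, mul_comm v,
    Nat.choose_succ_succ]
  rw [show n + 1 + m = n + m + 1 by ring] at h1
  rw [show n + (m + 1) = n + m + 1 by ring] at h2
  rw [h1, h2, Function.iterate_succ_apply _ m, Function.iterate_succ_apply _ n]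
  push_cast
  ring

variable {D}

theorem IsLocallyNilpotent.exists_iterate_ne_zero (hD : D.IsLocallyNilpotent) {u : R}
    (hu : u ≠ 0) : ∃ n : ℕ, D^[n] u ≠ 0 ∧ D^[n + 1] u = 0 := by
  classical
  have h := hD u
  obtain ⟨n, hn⟩ : ∃ n, Nat.find h = n + 1 :=
    Nat.exists_eq_succ_of_ne_zero fun h0 => hu (by simpa [h0] using Nat.find_spec h)
  exact ⟨n, Nat.find_min h (by omega), hn ▸ Nat.find_spec h⟩

theorem iterate_eq_zero_of_le {u : R} {n m : ℕ} (h : D^[n] u = 0) (hnm : n ≤ m) :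
    D^[m] u = 0 := by
  obtain ⟨j, rfl⟩ := Nat.exists_eq_add_of_le' hnm
  rw [Function.iterate_add_apply, h, iterate_map_zero]

variable [IsDomain R] [CharZero R]

theorem iterate_add_mul_ne_zero {n m : ℕ} {u v : R} (hu : D^[n + 1] u = 0)
    (hv : D^[m + 1] v = 0) (hu' : D^[n] u ≠ 0) (hv' : D^[m] v ≠ 0) :
    D^[n + m] (u * v) ≠ 0 := by
  rw [D.iterate_add_mul hu hv]
  refine mul_ne_zero ?_ (mul_ne_zero hu' hv')
  exact_mod_cast (Nat.choose_pos (Nat.le_add_right n m)).ne'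

/-- The kernel of a locally nilpotent derivation is factorially closed. -/
theorem IsLocallyNilpotent.apply_eq_zero_of_mul (hD : D.IsLocallyNilpotent) {u v : R}
    (h : D (u * v) = 0) (h0 : u * v ≠ 0) : D u = 0 := by
  obtain ⟨n, hn, hn'⟩ := hD.exists_iterate_ne_zero (left_ne_zero_of_mul h0)
  obtain ⟨m, hm, hm'⟩ := hD.exists_iterate_ne_zero (right_ne_zero_of_mul h0)
  have hne := iterate_add_mul_ne_zero hn' hm' hn hm
  have : n + m < 1 := by
    by_contra hc
    exact hne (iterate_eq_zero_of_le (n := 1) h (by omega))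
  obtain rfl : n = 0 := by omega
  simpa using hn'

/-- Were both derivatives nonzero, then $y\mid Dx$ would give $\deg_D y\le\deg_D x-1$, and $x\mid
Dy$ the reverse inequality. -/
theorem IsLocallyNilpotent.apply_eq_zero_or_of_dvd (hD : D.IsLocallyNilpotent) {x y : R}
    (hx : y ∣ D x) (hy : x ∣ D y) : D x = 0 ∨ D y = 0 := by
  by_contra! hc
  have key : ∀ {x y : R}, D x ≠ 0 → D y ≠ 0 → y ∣ D x → ∀ n m : ℕ,
      D^[n + 1] (D x) = 0 → D^[m] (D y) ≠ 0 → D^[m + 1] (D y) = 0 → m + 1 ≤ n := by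
    rintro x y hx hy ⟨u, hu⟩ n m hn hm hm'
    rw [hu] at hx hn
    obtain ⟨t, ht, ht'⟩ := hD.exists_iterate_ne_zero (right_ne_zero_of_mul hx)
    have := iterate_add_mul_ne_zero (n := m + 1) (u := y) hm' ht' hm ht
    by_contra hc
    exact this (iterate_eq_zero_of_le hn (by omega))
  obtain ⟨n, hn, hn'⟩ := hD.exists_iterate_ne_zero hc.1
  obtain ⟨m, hm, hm'⟩ := hD.exists_iterate_ne_zero hc.2
  have h1 := key hc.1 hc.2 hx n m hn' hm hm'
  have h2 := key hc.2 hc.1 hy m n hm' hn hn'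
  omega

end Derivation

/-! ### Weight filtration and Jacobian derivations -/

namespace MvPolynomial

section Filtration

variable {σ R : Type*} [CommRing R]

/-- All monomials of `p` have weight at most `n`, for integral weights `w`. -/
def WeightLE (w : σ → ℤ) (n : ℤ) (p : MvPolynomial σ R) : Prop :=
  ∀ m, coeff m p ≠ 0 → Finsupp.weight w m ≤ n

theorem WeightLE.sub {w : σ → ℤ} {n : ℤ} {p q : MvPolynomial σ R} (hp : WeightLE w n p)
    (hq : WeightLE w n q) : WeightLE w n (p - q) := by
  intro m hm
  rw [coeff_sub] at hm
  by_cases h : coeff m p = 0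
  · exact hq m fun h' => hm (by rw [h, h', sub_zero])
  · exact hp m h

theorem WeightLE.mul {w : σ → ℤ} {n k : ℤ} {p q : MvPolynomial σ R} (hp : WeightLE w n p)
    (hq : WeightLE w k q) : WeightLE w (n + k) (p * q) := by
  classical
  intro m hm
  rw [coeff_mul] at hm
  obtain ⟨⟨a, b⟩, hab, h⟩ := Finset.exists_ne_zero_of_sum_ne_zero hm
  rw [Finset.HasAntidiagonal.mem_antidiagonal] at hab
  simp only at hab h
  rw [← hab, map_add]
  exact add_le_add (hp a (left_ne_zero_of_mul h)) (hq b (right_ne_zero_of_mul h))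

theorem WeightLE.weightedHomogeneousComponent_mul {w : σ → ℤ} {n k : ℤ} {p q : MvPolynomial σ R}
    (hp : WeightLE w n p) (hq : WeightLE w k q) :
    weightedHomogeneousComponent w (n + k) (p * q) =
      weightedHomogeneousComponent w n p * weightedHomogeneousComponent w k q := by
  classical
  ext m
  rw [coeff_weightedHomogeneousComponent]
  simp only [coeff_mul, coeff_weightedHomogeneousComponent]
  trans ∑ x ∈ Finset.HasAntidiagonal.antidiagonal m,
    if Finsupp.weight w m = n + k then coeff x.1 p * coeff x.2 q else 0
  · split_ifs <;> simp
  refine Finset.sum_congr rfl fun ⟨a, b⟩ hab => ?_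
  rw [Finset.HasAntidiagonal.mem_antidiagonal] at hab
  simp only at hab ⊢
  have hm : Finsupp.weight w m = Finsupp.weight w a + Finsupp.weight w b := by
    rw [← hab, map_add]
  by_cases ha : coeff a p = 0
  · simp [ha]
  by_cases hb : coeff b q = 0
  · simp [hb]
  have h1 := hp a ha
  have h2 := hq b hb
  split_ifs <;> first | omega | simp

theorem WeightLE.pderiv {w : σ → ℤ} {n : ℤ} {p : MvPolynomial σ R} (hp : WeightLE w n p)
    (i : σ) : WeightLE w (n - w i) (pderiv i p) := by
  intro m hm
  rw [coeff_pderiv] at hm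
  have := hp _ (left_ne_zero_of_mul hm)
  rw [map_add, Finsupp.weight_single, one_smul] at this
  linarith

theorem weightedHomogeneousComponent_pderiv (w : σ → ℤ) (n : ℤ) (p : MvPolynomial σ R) (i : σ) :
    weightedHomogeneousComponent w (n - w i) (MvPolynomial.pderiv i p) =
      MvPolynomial.pderiv i (weightedHomogeneousComponent w n p) := by
  classical
  ext m
  simp only [coeff_weightedHomogeneousComponent, coeff_pderiv, map_add,
    Finsupp.weight_single, one_smul, eq_sub_iff_add_eq, ite_mul, zero_mul]

end Filtration

/-- The Jacobian derivation `g ↦ ∂(f, g) / ∂(x₀, x₁)`. -/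
noncomputable def jacobian {R : Type*} [CommRing R] (f : MvPolynomial (Fin 2) R) :
    Derivation R (MvPolynomial (Fin 2) R) (MvPolynomial (Fin 2) R) :=
  pderiv 0 f • pderiv 1 - pderiv 1 f • pderiv 0

section Jacobian

variable {R : Type*} [CommRing R]

theorem jacobian_apply (f g : MvPolynomial (Fin 2) R) :
    jacobian f g = pderiv 0 f * pderiv 1 g - pderiv 1 f * pderiv 0 g := rfl

theorem jacobian_self (f : MvPolynomial (Fin 2) R) : jacobian f f = 0 := by
  rw [jacobian_apply, mul_comm, sub_self]

theorem jacobian_swap (f g : MvPolynomial (Fin 2) R) : jacobian g f = -jacobian f g := by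
  simp only [jacobian_apply]; ring

theorem jacobian_X_zero (f : MvPolynomial (Fin 2) R) : jacobian f (X 0) = -pderiv 1 f := by
  simp [jacobian_apply]

theorem jacobian_X_one (f : MvPolynomial (Fin 2) R) : jacobian f (X 1) = pderiv 0 f := by
  simp [jacobian_apply]

variable {w : Fin 2 → ℤ} {d n : ℤ} {f g : MvPolynomial (Fin 2) R}

theorem WeightLE.jacobian (hf : WeightLE w d f) (hg : WeightLE w n g) :
    WeightLE w (n + (d - w 0 - w 1)) (jacobian f g) := by
  rw [jacobian_apply]
  apply WeightLE.sub
  · convert (hf.pderiv 0).mul (hg.pderiv 1) using 1; ring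
  · convert (hf.pderiv 1).mul (hg.pderiv 0) using 1; ring

theorem WeightLE.weightedHomogeneousComponent_jacobian (hf : WeightLE w d f)
    (hg : WeightLE w n g) :
    weightedHomogeneousComponent w (n + (d - w 0 - w 1)) (MvPolynomial.jacobian f g) =
      MvPolynomial.jacobian (weightedHomogeneousComponent w d f)
        (weightedHomogeneousComponent w n g) := by
  simp only [jacobian_apply, map_sub, ← weightedHomogeneousComponent_pderiv]
  rw [← (hf.pderiv 0).weightedHomogeneousComponent_mul (hg.pderiv 1),
    ← (hf.pderiv 1).weightedHomogeneousComponent_mul (hg.pderiv 0)]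
  congr 3 <;> ring

theorem WeightLE.weightedHomogeneousComponent_iterate_jacobian (hf : WeightLE w d f)
    (hg : WeightLE w n g) (k : ℕ) :
    WeightLE w (n + k * (d - w 0 - w 1)) ((MvPolynomial.jacobian f)^[k] g) ∧
    weightedHomogeneousComponent w (n + k * (d - w 0 - w 1)) ((MvPolynomial.jacobian f)^[k] g) =
      (MvPolynomial.jacobian (weightedHomogeneousComponent w d f))^[k]
        (weightedHomogeneousComponent w n g) := by
  induction k with
  | zero => simpa using hg
  | succ k ih =>
    have e : n + ((k + 1 : ℕ) : ℤ) * (d - w 0 - w 1) =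
      n + k * (d - w 0 - w 1) + (d - w 0 - w 1) := by push_cast; ring
    rw [e, Function.iterate_succ_apply', Function.iterate_succ_apply', ← ih.2]
    exact ⟨hf.jacobian ih.1, hf.weightedHomogeneousComponent_jacobian ih.1⟩

/-- On a monomial, the iterates for the component are the extremal components of the iterates for
`f`, so they vanish as soon as the latter do. Weights are integral because the shift $d-w_0-w_1$ may
be negative. -/
theorem isLocallyNilpotent_jacobian_weightedHomogeneousComponent (hf : WeightLE w d f)
    (hD : (MvPolynomial.jacobian f).IsLocallyNilpotent) :
    (MvPolynomial.jacobian (weightedHomogeneousComponent w d f)).IsLocallyNilpotent := by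
  classical
  intro g
  induction g using MvPolynomial.induction_on' with
  | monomial s a =>
    have hle : WeightLE w (Finsupp.weight w s) (monomial s a) := by
      intro m hm
      rw [coeff_monomial] at hm
      split_ifs at hm with h
      · rw [h]
      · exact absurd rfl hm
    obtain ⟨k, hk⟩ := hD (monomial s a)
    have h := (hf.weightedHomogeneousComponent_iterate_jacobian hle k).2
    rw [hk, map_zero, (isWeightedHomogeneous_monomial w s a
      rfl).weightedHomogeneousComponent_same] at h
    exact ⟨k, h.symm⟩
  | add p q hp hq =>
    obtain ⟨k, hk⟩ := hp
    obtain ⟨l, hl⟩ := hq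
    refine ⟨max k l, ?_⟩
    rw [iterate_map_add, Derivation.iterate_eq_zero_of_le hk (le_max_left k l),
      Derivation.iterate_eq_zero_of_le hl (le_max_right k l), add_zero]

end Jacobian

end MvPolynomial

/-! ### Jacobian derivations attached to automorphisms -/

namespace MvPolynomial

theorem isLocallyNilpotent_pderiv {σ R : Type*} [CommRing R] (j : σ) :
    (pderiv (R := R) j).IsLocallyNilpotent := by
  classical
  intro g
  induction g using MvPolynomial.induction_on' with
  | monomial s a =>
    suffices h : ∀ n : ℕ, ∀ s a, s j < n → (pderiv (R := R) j)^[n] (monomial s a) = 0 from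
      ⟨s j + 1, h _ s a (Nat.lt_succ_self _)⟩
    intro n
    induction n with
    | zero => intro s a h; omega
    | succ n ih =>
      intro s a h
      rw [Function.iterate_succ_apply, pderiv_monomial]
      rcases Nat.eq_zero_or_pos (s j) with h0 | h0
      · simp [h0]
      · apply ih
        simp only [Finsupp.coe_tsub, Pi.sub_apply, Finsupp.single_eq_same]
        omega
  | add p q hp hq =>
    obtain ⟨k, hk⟩ := hp
    obtain ⟨l, hl⟩ := hq
    refine ⟨max k l, ?_⟩
    rw [iterate_map_add, Derivation.iterate_eq_zero_of_le hk (le_max_left k l),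
      Derivation.iterate_eq_zero_of_le hl (le_max_right k l), add_zero]

theorem derivation_bind₁ {σ τ R : Type*} [CommRing R] [Fintype σ]
    (D : Derivation R (MvPolynomial τ R) (MvPolynomial τ R)) (F : σ → MvPolynomial τ R)
    (h : MvPolynomial σ R) :
    D (bind₁ F h) = ∑ i, bind₁ F (pderiv i h) * D (F i) := by
  classical
  induction h using MvPolynomial.induction_on with
  | C a => simp
  | add p q hp hq => simp [hp, hq, add_mul, Finset.sum_add_distrib]
  | mul_X p n hp =>
    simp only [map_mul, Derivation.leibniz, bind₁_X_right, hp, smul_eq_mul, map_add, pderiv_X,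
      add_mul, Finset.sum_add_distrib, Finset.mul_sum]
    congr 1
    · rw [Finset.sum_eq_single n (by intro b _ hb; simp [Ne.symm hb]) (by simp)]
      simp
    · exact Finset.sum_congr rfl fun i _ => by ring

end MvPolynomial

namespace PolyMap

open MvPolynomial

variable {F : PolyMap 2}

/-- Chain rule for $G\circ F=\mathrm{id}$: the two Jacobian determinants multiply to $1$. -/
theorem isUnit_jacobian (hF : F.IsAutomorphism) : IsUnit (jacobian (F 0) (F 1)) := by
  obtain ⟨G, -, h⟩ := hF
  have key : ∀ i k : Fin 2, pderiv i (X k : MvPolynomial (Fin 2) ℂ) =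
      bind₁ F (pderiv 0 (G k)) * pderiv i (F 0) + bind₁ F (pderiv 1 (G k)) * pderiv i (F 1) := by
    intro i k
    rw [← Fin.sum_univ_two (f := fun j => bind₁ F (pderiv j (G k)) * pderiv i (F j)),
      ← derivation_bind₁]
    exact congrArg _ (congrFun h k).symm
  have h00 := key 0 0
  have h01 := key 0 1
  have h10 := key 1 0
  have h11 := key 1 1
  simp only [pderiv_X_self, pderiv_X_of_ne zero_ne_one, pderiv_X_of_ne one_ne_zero]
    at h00 h01 h10 h11
  refine IsUnit.of_mul_eq_one (bind₁ F (jacobian (G 0) (G 1))) ?_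
  rw [jacobian_apply, jacobian_apply, map_sub, map_mul, map_mul]
  generalize bind₁ F (pderiv 0 (G 0)) = a at *
  generalize bind₁ F (pderiv 0 (G 1)) = b at *
  generalize bind₁ F (pderiv 1 (G 0)) = c at *
  generalize bind₁ F (pderiv 1 (G 1)) = d at *
  generalize pderiv 0 (F 0) = x at *
  generalize pderiv 1 (F 0) = y at *
  generalize pderiv 0 (F 1) = z at *
  generalize pderiv 1 (F 1) = t at *
  linear_combination (-1 : MvPolynomial (Fin 2) ℂ) * h11 - (b * y + d * t) * h00 + (a * y + c * t) * h01

theorem exists_jacobian_eq_C (hF : F.IsAutomorphism) :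
    ∃ c : ℂ, c ≠ 0 ∧ jacobian (F 0) (F 1) = C c := by
  obtain ⟨c, hc, h⟩ := isUnit_iff_eq_C_of_isReduced.1 (isUnit_jacobian hF)
  exact ⟨c, hc.ne_zero, h⟩

theorem isLocallyNilpotent_jacobian (hF : F.IsAutomorphism) (i : Fin 2) :
    (jacobian (F i)).IsLocallyNilpotent := by
  obtain ⟨c, -, hc⟩ := exists_jacobian_eq_C hF
  obtain ⟨G, -, hG⟩ := hF
  -- Substitution of `F` intertwines the derivation with $\pm c\,\partial_j$, where $j\ne i$; it is
  -- surjective because `F` is invertible.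
  obtain ⟨j, e, he⟩ : ∃ (j : Fin 2) (e : ℂ), ∀ h,
      jacobian (F i) (bind₁ F h) = C e * bind₁ F (pderiv j h) := by
    simp only [derivation_bind₁, Fin.sum_univ_two]
    fin_cases i
    · exact ⟨1, c, fun h => by simp [jacobian_self, hc, mul_comm]⟩
    · refine ⟨0, -c, fun h => ?_⟩
      simp [jacobian_self, jacobian_swap (F 0) (F 1), hc, mul_comm]
  have hiter : ∀ (n : ℕ) h, (jacobian (F i))^[n] (bind₁ F h) =
      C (e ^ n) * bind₁ F ((pderiv j)^[n] h) := by
    intro n h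
    induction n with
    | zero => simp
    | succ n ih =>
      rw [Function.iterate_succ_apply', Function.iterate_succ_apply', ih, ← smul_eq_C_mul,
        Derivation.map_smul, he, smul_eq_C_mul, pow_succ, C_mul, mul_assoc]
  intro g
  have hg : bind₁ F (bind₁ G g) = g := by
    rw [bind₁_bind₁]
    have : (fun k => bind₁ F (G k)) = X := hG
    rw [this, bind₁_X_left, AlgHom.id_apply]
  obtain ⟨n, hn⟩ := isLocallyNilpotent_pderiv j (bind₁ G g)
  exact ⟨n, by rw [← hg, hiter, hn, map_zero, mul_zero]⟩

end PolyMap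

/-! ### Restriction to the axes and leading forms -/

namespace MvPolynomial

section Axis

/-- The restriction of a polynomial in two variables to the `j`-th coordinate axis. -/
noncomputable def axis {R : Type*} [CommRing R] (j : Fin 2) :
    MvPolynomial (Fin 2) R →ₐ[R] Polynomial R :=
  aeval (Pi.single j Polynomial.X)

variable {R : Type*} [CommRing R]

theorem coeff_axis (j : Fin 2) (p : MvPolynomial (Fin 2) R) (n : ℕ) :
    (axis j p).coeff n = coeff (Finsupp.single j n) p := by
  classical
  induction p using MvPolynomial.induction_on' with
  | add p q hp hq => simp [hp, hq]
  | monomial s a =>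
    rw [axis, aeval_monomial, Finsupp.prod_fintype _ _ (fun i => pow_zero _), Fin.prod_univ_two,
      coeff_monomial, Polynomial.algebraMap_eq, Polynomial.coeff_C_mul]
    have hs : s = Finsupp.single j n ↔ s 0 = Finsupp.single j n 0 ∧
        s 1 = Finsupp.single j n 1 :=
      ⟨fun h => by simp [h], fun h => Finsupp.ext fun k => by fin_cases k; exacts [h.1, h.2]⟩
    rw [if_congr hs rfl rfl]
    fin_cases j
    · rcases eq_or_ne (s 1) 0 with h | h
      · simp [h, Polynomial.coeff_X_pow, eq_comm]
      · simp [h]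
    · rcases eq_or_ne (s 0) 0 with h | h
      · simp [h, Polynomial.coeff_X_pow, eq_comm]
      · simp [h]

theorem X_dvd_of_axis_eq_zero {i j : Fin 2} (hij : i ≠ j) {p : MvPolynomial (Fin 2) R}
    (h : axis j p = 0) : X i ∣ p := by
  classical
  rw [X_dvd_iff_modMonomial_eq_zero]
  ext m
  by_cases hm : Finsupp.single i 1 ≤ m
  · rw [coeff_modMonomial_of_le _ hm, coeff_zero]
  · rw [coeff_modMonomial_of_not_le _ hm, coeff_zero]
    have h0 : m i = 0 := by
      by_contra h0
      exact hm (Finsupp.single_le_iff.2 (Nat.one_le_iff_ne_zero.2 h0))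
    have : m = Finsupp.single j (m j) := by
      ext k
      by_cases hk : k = j
      · simp [hk]
      · obtain rfl : k = i := by omega
        simp [h0, Ne.symm hk]
    rw [this, ← coeff_axis, h, Polynomial.coeff_zero]

end Axis

section LeadingForm

variable {T : MvPolynomial (Fin 2) ℂ}

theorem pderiv_ne_zero_of_coeff_ne_zero {σ : Type*} {T : MvPolynomial σ ℂ} {m : σ →₀ ℕ} {i : σ}
    (hm : coeff m T ≠ 0) (hi : m i ≠ 0) : pderiv i T ≠ 0 := by
  classical
  intro h
  have h1 := congrArg (coeff (m - Finsupp.single i 1)) h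
  rw [coeff_pderiv, tsub_add_cancel_of_le (Finsupp.single_le_iff.2 (Nat.one_le_iff_ne_zero.2 hi)),
    coeff_zero] at h1
  exact mul_ne_zero hm (by exact Nat.cast_add_one_ne_zero _) h1

/-- The other variable $x_i$ divides $T$, and $T$ lies in the kernel of its own Jacobian derivation;
factorial closedness puts $x_i$ in the kernel too. -/
theorem pderiv_eq_zero_of_axis_eq_zero (hD : (jacobian T).IsLocallyNilpotent) (hT : T ≠ 0)
    {j : Fin 2} (h : axis j T = 0) : pderiv j T = 0 := by
  have key : ∀ i : Fin 2, i ≠ j → jacobian T (X i) = 0 := by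
    intro i hij
    obtain ⟨v, hv⟩ := X_dvd_of_axis_eq_zero hij h
    exact hD.apply_eq_zero_of_mul (v := v) (by rw [← hv, jacobian_self]) (by rwa [← hv])
  fin_cases j
  · simpa [jacobian_X_one] using key 1 (by simp)
  · simpa [jacobian_X_zero] using key 0 (by simp)

end LeadingForm

section WeightedDegree

variable {w : Fin 2 → ℕ} {p : MvPolynomial (Fin 2) ℂ}

theorem weight_fin_two {M : Type*} [AddCommMonoid M] (w : Fin 2 → M) (m : Fin 2 →₀ ℕ) :
    Finsupp.weight w m = m 0 • w 0 + m 1 • w 1 := by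
  rw [Finsupp.weight_apply, Finsupp.sum_fintype _ _ (by simp), Fin.sum_univ_two]

theorem weight_natCast (w : Fin 2 → ℕ) (m : Fin 2 →₀ ℕ) :
    Finsupp.weight (fun i => (w i : ℤ)) m = (Finsupp.weight w m : ℕ) := by
  simp [weight_fin_two]

/-- The leading form of `p` with respect to the weight `w`. -/
noncomputable def leadingForm (w : Fin 2 → ℕ) (p : MvPolynomial (Fin 2) ℂ) :
    MvPolynomial (Fin 2) ℂ :=
  weightedHomogeneousComponent (fun i => (w i : ℤ)) (weightedTotalDegree w p : ℕ) p

theorem weightLE_weightedTotalDegree (w : Fin 2 → ℕ) (p : MvPolynomial (Fin 2) ℂ) :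
    WeightLE (fun i => (w i : ℤ)) (weightedTotalDegree w p : ℕ) p := by
  intro m hm
  rw [weight_natCast]
  exact_mod_cast le_weightedTotalDegree w (mem_support_iff.2 hm)

theorem coeff_leadingForm (m : Fin 2 →₀ ℕ) :
    coeff m (leadingForm w p) =
      if Finsupp.weight w m = weightedTotalDegree w p then coeff m p else 0 := by
  classical
  rw [leadingForm, coeff_weightedHomogeneousComponent, weight_natCast]
  simp only [Nat.cast_inj]

theorem leadingForm_ne_zero (hp : p ≠ 0) : leadingForm w p ≠ 0 := by
  obtain ⟨m, hm, h⟩ := Finset.exists_mem_eq_sup p.support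
    (support_nonempty.2 hp) (Finsupp.weight w)
  intro h0
  have := congrArg (coeff m) h0
  rw [coeff_leadingForm, weightedTotalDegree, if_pos h.symm, coeff_zero] at this
  exact mem_support_iff.1 hm this

theorem exists_pderiv_leadingForm_ne_zero (hp : p ≠ 0) (hd : weightedTotalDegree w p ≠ 0) :
    pderiv 0 (leadingForm w p) ≠ 0 ∨ pderiv 1 (leadingForm w p) ≠ 0 := by
  obtain ⟨m, hm⟩ := ne_zero_iff.1 (leadingForm_ne_zero (w := w) hp)
  have hw : Finsupp.weight w m = weightedTotalDegree w p := by
    by_contra h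
    exact hm (by rw [coeff_leadingForm, if_neg h])
  rw [weight_fin_two] at hw
  by_cases h0 : m 0 = 0
  · refine Or.inr (pderiv_ne_zero_of_coeff_ne_zero hm fun h1 => hd ?_)
    rw [← hw, h0, h1, zero_smul, zero_smul, add_zero]
  · exact Or.inl (pderiv_ne_zero_of_coeff_ne_zero hm h0)

end WeightedDegree

end MvPolynomial

/-! ### Degrees of one component on the two axes -/

namespace PolyMap

open MvPolynomial

variable {F : PolyMap 2}

theorem isLocallyNilpotent_jacobian_leadingForm (hF : F.IsAutomorphism) (w : Fin 2 → ℕ)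
    (i : Fin 2) : (jacobian (leadingForm w (F i))).IsLocallyNilpotent :=
  isLocallyNilpotent_jacobian_weightedHomogeneousComponent (weightLE_weightedTotalDegree w (F i))
    (isLocallyNilpotent_jacobian hF i)

theorem dvd_or_dvd_natDegree_axis (hF : F.IsAutomorphism) (i : Fin 2)
    (h0 : (axis 0 (F i)).natDegree ≠ 0) (h1 : (axis 1 (F i)).natDegree ≠ 0) :
    (axis 0 (F i)).natDegree ∣ (axis 1 (F i)).natDegree ∨
      (axis 1 (F i)).natDegree ∣ (axis 0 (F i)).natDegree := by
  set f := F i with hf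
  set k := (axis 0 f).natDegree with hk
  set l := (axis 1 f).natDegree with hl
  have hck : coeff (Finsupp.single 0 k) f ≠ 0 := by
    rw [← coeff_axis, hk, ← Polynomial.leadingCoeff, Polynomial.leadingCoeff_ne_zero]
    rintro h
    exact h0 (by rw [hk, h, Polynomial.natDegree_zero])
  have hcl : coeff (Finsupp.single 1 l) f ≠ 0 := by
    rw [← coeff_axis, hl, ← Polynomial.leadingCoeff, Polynomial.leadingCoeff_ne_zero]
    rintro h
    exact h1 (by rw [hl, h, Polynomial.natDegree_zero])
  have hf0 : f ≠ 0 := fun h => hck (by rw [h, coeff_zero])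
  obtain ⟨q, p, hqp, hkq, hlp⟩ := Nat.exists_coprime k l
  set g := k.gcd l with hg
  have hg0 : 0 < g := Nat.gcd_pos_of_pos_left _ (Nat.pos_of_ne_zero h0)
  have hp0 : 0 < p := Nat.pos_of_ne_zero fun h => h1 (by rw [hlp, h, zero_mul])
  have hq0 : 0 < q := Nat.pos_of_ne_zero fun h => h0 (by rw [hkq, h, zero_mul])
  -- This weight, the edge direction in the Newton polygon, gives $x^k$ and $y^l$ equal weight.
  set w : Fin 2 → ℕ := ![p, q] with hw
  have hwt : ∀ m, Finsupp.weight w m = m 0 * p + m 1 * q := fun m => by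
    simp [weight_fin_two, hw]
  have hT0 := leadingForm_ne_zero (w := w) hf0
  have hcT := fun m => coeff_leadingForm (w := w) (p := f) m
  have hD := isLocallyNilpotent_jacobian_leadingForm hF w i
  rw [← hf] at hD
  have hkl : k * p = l * q := by rw [hkq, hlp]; ring
  have hdk : k * p ≤ weightedTotalDegree w f := by
    have := le_weightedTotalDegree w (mem_support_iff.2 hck)
    rw [hwt] at this
    simpa using this
  have hex := exists_pderiv_leadingForm_ne_zero (w := w) hf0
    (by have := Nat.mul_pos (Nat.pos_of_ne_zero h0) hp0; omega)
  set d := weightedTotalDegree w f with hd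
  set T := leadingForm w f with hT
  -- In a larger degree the leading form would vanish on both axes, hence be constant, which is
  -- excluded by `hex`.
  have hdk' : d = k * p := by
    refine le_antisymm (not_lt.1 fun hlt => ?_) hdk
    have a0 : axis 0 T = 0 := by
      ext n
      rw [coeff_axis, hcT, Polynomial.coeff_zero, hwt, ite_eq_right_iff]
      intro hn
      rw [← coeff_axis]
      apply Polynomial.coeff_eq_zero_of_natDegree_lt
      simp only [Finsupp.single_eq_same, ne_eq, one_ne_zero, not_false_eq_true,
        Finsupp.single_eq_of_ne, zero_mul, add_zero] at hn
      exact lt_of_mul_lt_mul_right (hn ▸ hlt) hp0.le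
    have a1 : axis 1 T = 0 := by
      ext n
      rw [coeff_axis, hcT, Polynomial.coeff_zero, hwt, ite_eq_right_iff]
      intro hn
      rw [← coeff_axis]
      apply Polynomial.coeff_eq_zero_of_natDegree_lt
      simp only [Finsupp.single_eq_same, ne_eq, zero_ne_one, not_false_eq_true,
        Finsupp.single_eq_of_ne, zero_mul, zero_add] at hn
      exact lt_of_mul_lt_mul_right (hn ▸ hkl ▸ hlt) hq0.le
    rcases hex with h | h
    · exact h (pderiv_eq_zero_of_axis_eq_zero hD hT0 a0)
    · exact h (pderiv_eq_zero_of_axis_eq_zero hD hT0 a1)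
  by_contra! hc
  have hp1 : p ≠ 1 := fun h => hc.2 ⟨q, by rw [hkq, hlp, h]; ring⟩
  have hq1 : q ≠ 1 := fun h => hc.1 ⟨p, by rw [hkq, hlp, h]; ring⟩
  -- A monomial $x^n y$ of `T` would give $np+q=kp$, so $p\mid q$ and, by coprimality, $p=1$. Thus
  -- $y\mid\partial_yT$; symmetrically $x\mid\partial_xT$.
  have e1 : axis 0 (pderiv 1 T) = 0 := by
    ext n
    rw [coeff_axis, coeff_pderiv, hcT, Polynomial.coeff_zero, hwt, if_neg, zero_mul]
    intro hn
    simp at hn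
    have : p ∣ q := (Nat.dvd_add_right (Dvd.intro_left n rfl)).1 (hn ▸ hdk' ▸ Dvd.intro_left k rfl)
    exact hp1 (Nat.eq_one_of_dvd_coprimes hqp this dvd_rfl)
  have e0 : axis 1 (pderiv 0 T) = 0 := by
    ext n
    rw [coeff_axis, coeff_pderiv, hcT, Polynomial.coeff_zero, hwt, if_neg, zero_mul]
    intro hn
    simp at hn
    have : q ∣ p := (Nat.dvd_add_left (Dvd.intro_left n rfl)).1
      (hn ▸ hdk' ▸ hkl ▸ Dvd.intro_left l rfl)
    exact hq1 (Nat.eq_one_of_dvd_coprimes hqp dvd_rfl this)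
  have n0 : pderiv 0 T ≠ 0 := by
    refine pderiv_ne_zero_of_coeff_ne_zero (m := Finsupp.single 0 k) ?_ (by simpa using h0)
    rw [hcT, hwt, if_pos (by simp [hdk'])]
    exact hck
  have n1 : pderiv 1 T ≠ 0 := by
    refine pderiv_ne_zero_of_coeff_ne_zero (m := Finsupp.single 1 l) ?_ (by simpa using h1)
    rw [hcT, hwt, if_pos (by simp [hdk', hkl])]
    exact hcl
  rcases hD.apply_eq_zero_or_of_dvd (x := X 0) (y := X 1)
      (by rw [jacobian_X_zero, dvd_neg]; exact X_dvd_of_axis_eq_zero one_ne_zero e1)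
      (by rw [jacobian_X_one]; exact X_dvd_of_axis_eq_zero zero_ne_one e0) with h | h
  · exact n1 (by simpa [jacobian_X_zero] using h)
  · exact n0 (by simpa [jacobian_X_one] using h)

end PolyMap

/-! ### Axis degrees of an automorphism and of its inverse -/

namespace Polynomial

theorem natDegree_le_of_adjoinRoot_surjective {p q : Polynomial ℂ} (hp : p ≠ 0)
    (φ : Polynomial ℂ →ₐ[ℂ] AdjoinRoot q) (hφ : Function.Surjective φ) (h0 : φ p = 0) :
    q ≠ 0 ∧ q.natDegree ≤ p.natDegree := by
  have hker : p.eval₂ (Algebra.ofId ℂ (AdjoinRoot q)) (φ X) = 0 := by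
    change aeval (φ X) p = 0
    rw [aeval_algHom_apply, aeval_X_left_apply, h0]
  set ψ := AdjoinRoot.liftAlgHom p (Algebra.ofId ℂ (AdjoinRoot q)) (φ X) hker
  have hψ : Function.Surjective ψ := by
    intro y
    obtain ⟨u, rfl⟩ := hφ y
    refine ⟨AdjoinRoot.mk p u, ?_⟩
    rw [AdjoinRoot.liftAlgHom_mk]
    change aeval (φ X) u = φ u
    rw [aeval_algHom_apply, aeval_X_left_apply]
  have hfin : Module.Finite ℂ (AdjoinRoot p) := (AdjoinRoot.powerBasis hp).finite
  have hfin' : Module.Finite ℂ (AdjoinRoot q) := Module.Finite.of_surjective ψ.toLinearMap hψ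
  refine ⟨?_, ?_⟩
  -- If $q=0$ the quotient would be $\mathbb{C}[x]$, whose variable is not integral over
  -- $\mathbb{C}$.
  · obtain ⟨r, hr, h⟩ := IsIntegral.of_finite ℂ (AdjoinRoot.root q)
    rintro rfl
    have h' : aeval (AdjoinRoot.root (0 : Polynomial ℂ)) r = 0 := h
    rw [AdjoinRoot.aeval_eq, AdjoinRoot.mk_eq_zero, zero_dvd_iff] at h'
    exact hr.ne_zero h'
  · have h := LinearMap.finrank_le_finrank_of_surjective (f := ψ.toLinearMap) hψ
    have e : ∀ r : Polynomial ℂ, Module.finrank ℂ (AdjoinRoot r) = r.natDegree :=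
      fun r => finrank_quotient_span_eq_natDegree
    rwa [e, e] at h

end Polynomial

namespace PolyMap

open MvPolynomial

variable {F : PolyMap 2}

/-- Both degrees count the intersection of $\{F_i=0\}$ with the line $x_{j'}=0$: `G` carries
$\mathbb{C}[x,y]/(F_i,x_{j'})$ onto $\mathbb{C}[x,y]/(x_i,G_{j'})$, and each quotient reduces to one
variable. -/
theorem natDegree_axis_inverse_le {F G : PolyMap 2} (hFG : F.comp G = identity 2) {i i' j j' : Fin 2}
    (hi : i' ≠ i) (hj : j' ≠ j) (h0 : axis j (F i) ≠ 0) :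
    axis i' (G j') ≠ 0 ∧ (axis i' (G j')).natDegree ≤ (axis j (F i)).natDegree := by
  set q := axis i' (G j') with hq
  set φ : Polynomial ℂ →ₐ[ℂ] AdjoinRoot q :=
    Polynomial.aeval (AdjoinRoot.mk q (axis i' (G j))) with hφ
  have hFG' : ∀ k, bind₁ G (F k) = X k := fun k => congrFun hFG k
  have key : φ.comp (axis j) = ((AdjoinRoot.mkₐ q).comp (axis i')).comp (bind₁ G) := by
    refine MvPolynomial.algHom_ext fun k => ?_
    by_cases hk : k = j
    · subst hk
      simp [axis, hφ]
    · obtain rfl : k = j' := by omega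
      simp only [AlgHom.comp_apply, bind₁_X_right]
      change φ (axis j (X k)) = AdjoinRoot.mk q q
      rw [AdjoinRoot.mk_self, axis, aeval_X, Pi.single_eq_of_ne hk, map_zero]
  have key' : ∀ k, φ (axis j (F k)) = AdjoinRoot.mk q (axis i' (X k)) := fun k => by
    rw [← hFG' k]
    exact DFunLike.congr_fun key (F k)
  refine Polynomial.natDegree_le_of_adjoinRoot_surjective h0 φ ?_ ?_
  · intro y
    obtain ⟨r, rfl⟩ := AdjoinRoot.mk_surjective y
    refine ⟨Polynomial.aeval (axis j (F i')) r, ?_⟩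
    rw [← Polynomial.aeval_algHom_apply, key', axis, aeval_X, Pi.single_eq_same, AdjoinRoot.mk_X,
      AdjoinRoot.aeval_eq]
  · rw [key', axis, aeval_X, Pi.single_eq_of_ne hi.symm, map_zero]

theorem natDegree_axis_inverse {F G : PolyMap 2} (hFG : F.comp G = identity 2)
    (hGF : G.comp F = identity 2) {i i' j j' : Fin 2}
    (hi : i' ≠ i) (hj : j' ≠ j) (h0 : axis j (F i) ≠ 0) :
    (axis i' (G j')).natDegree = (axis j (F i)).natDegree := by
  obtain ⟨h, hle⟩ := natDegree_axis_inverse_le hFG hi hj h0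
  exact le_antisymm hle (natDegree_axis_inverse_le hGF hj.symm hi.symm h).2

/-- The two components on one axis become one component of the inverse on the two axes. -/
theorem natDegree_axis_dvd_or_dvd (hF : F.IsAutomorphism) (j : Fin 2)
    (h0 : (axis j (F 0)).natDegree ≠ 0) (h1 : (axis j (F 1)).natDegree ≠ 0) :
    (axis j (F 0)).natDegree ∣ (axis j (F 1)).natDegree ∨
      (axis j (F 1)).natDegree ∣ (axis j (F 0)).natDegree := by
  obtain ⟨G, hFG, hGF⟩ := hF
  obtain ⟨j', hj⟩ : ∃ j', j' ≠ j := exists_ne j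
  have e0 := natDegree_axis_inverse hFG hGF (one_ne_zero) hj
    (fun h => h0 (by rw [h, Polynomial.natDegree_zero]))
  have e1 := natDegree_axis_inverse hFG hGF (zero_ne_one) hj
    (fun h => h1 (by rw [h, Polynomial.natDegree_zero]))
  rw [← e0] at h0 ⊢
  rw [← e1] at h1 ⊢
  exact (dvd_or_dvd_natDegree_axis ⟨F, hGF, hFG⟩ j' h1 h0).symm

/-! ### Constraints on the weighted degrees -/

variable {w : Fin 2 → ℕ}

theorem weightedTotalDegree_eq_natDegree_axis_mul {p : MvPolynomial (Fin 2) ℂ} {j : Fin 2}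
    (h : axis j (leadingForm w p) ≠ 0) :
    weightedTotalDegree w p = (axis j p).natDegree * w j := by
  have hwt : ∀ n, Finsupp.weight w (Finsupp.single j n) = n * w j := fun n => by
    rw [Finsupp.weight_single, smul_eq_mul]
  obtain ⟨n, hn⟩ : ∃ n, (axis j (leadingForm w p)).coeff n ≠ 0 := by
    by_contra! hc
    exact h (Polynomial.ext hc)
  rw [coeff_axis, coeff_leadingForm, ne_eq, ite_eq_right_iff, Classical.not_imp, hwt,
    ← coeff_axis] at hn
  have hn' := Polynomial.le_natDegree_of_ne_zero hn.2
  have hp : axis j p ≠ 0 := fun h => hn.2 (by rw [h, Polynomial.coeff_zero])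
  have hle := le_weightedTotalDegree w (φ := p) (d := Finsupp.single j (axis j p).natDegree)
    (mem_support_iff.2 (by
      rw [← coeff_axis]; exact Polynomial.leadingCoeff_ne_zero.2 hp))
  rw [hwt] at hle
  exact le_antisymm (hn.1 ▸ Nat.mul_le_mul_right _ hn') hle

theorem pderiv_eq_zero_of_weightedTotalDegree_lt {p : MvPolynomial (Fin 2) ℂ} {j : Fin 2}
    (h : weightedTotalDegree w p < w j) : pderiv j p = 0 := by
  ext m
  rw [coeff_pderiv, coeff_zero]
  by_contra hc
  have := le_weightedTotalDegree w (mem_support_iff.2 (left_ne_zero_of_mul hc))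
  rw [map_add, Finsupp.weight_single, one_smul] at this
  omega

theorem weightedTotalDegree_eq_of_pderiv {p : MvPolynomial (Fin 2) ℂ} {i j : Fin 2} (hij : i ≠ j)
    (hj : pderiv j p = 0) (hi : IsUnit (pderiv i p)) : weightedTotalDegree w p = w i := by
  classical
  obtain ⟨e, he, h⟩ := isUnit_iff_eq_C_of_isReduced.1 hi
  apply le_antisymm
  · refine Finset.sup_le fun m hm => ?_
    rw [mem_support_iff] at hm
    have h0 : m j = 0 := by
      by_contra h0
      exact pderiv_ne_zero_of_coeff_ne_zero hm h0 hj
    have h1 : m i ≤ 1 := by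
      by_contra! h1
      have hc := coeff_pderiv (i := i) p (m - Finsupp.single i 1)
      rw [tsub_add_cancel_of_le (Finsupp.single_le_iff.2 (by omega)), h, coeff_C, if_neg] at hc
      · exact mul_ne_zero hm (Nat.cast_add_one_ne_zero _) hc.symm
      · intro h2
        have := DFunLike.congr_fun h2 i
        simp at this
        omega
    have : m = Finsupp.single i (m i) := by
      ext k
      by_cases hk : k = i
      · simp [hk]
      · obtain rfl : k = j := by omega
        simp [h0, Ne.symm hk]
    rw [this, Finsupp.weight_single, smul_eq_mul]
    exact (Nat.mul_le_mul_right _ h1).trans_eq (one_mul _)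
  · have hc : coeff (Finsupp.single i 1) p ≠ 0 := by
      have hc := coeff_pderiv (i := i) p 0
      rw [h, coeff_zero_C, zero_add] at hc
      intro h0
      rw [h0, zero_mul] at hc
      exact he.ne_zero hc
    have := le_weightedTotalDegree w (mem_support_iff.2 hc)
    rwa [Finsupp.weight_single, one_smul] at this

/-- Such a component is free of $x_j$, and its derivative in $x_i$ divides the constant Jacobian, so
it is affine in $x_i$. -/
theorem weightedTotalDegree_eq_of_lt (hF : F.IsAutomorphism) (k : Fin 2) {i j : Fin 2} (hij : i ≠ j)
    (h : weightedTotalDegree w (F k) < w j) : weightedTotalDegree w (F k) = w i := by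
  have h0 := pderiv_eq_zero_of_weightedTotalDegree_lt h
  refine weightedTotalDegree_eq_of_pderiv hij h0 (isUnit_of_dvd_unit ?_ (isUnit_jacobian hF))
  rw [jacobian_apply]
  fin_cases i <;> fin_cases j <;> fin_cases k <;> simp_all

theorem exists_weight_le (hF : F.IsAutomorphism) (j : Fin 2) :
    w j ≤ weightedTotalDegree w (F 0) ∨ w j ≤ weightedTotalDegree w (F 1) := by
  by_contra! hc
  apply (isUnit_jacobian hF).ne_zero
  have h0 := pderiv_eq_zero_of_weightedTotalDegree_lt hc.1
  have h1 := pderiv_eq_zero_of_weightedTotalDegree_lt hc.2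
  rw [jacobian_apply]
  fin_cases j <;> simp_all

theorem component_nonconstant (hF : F.IsAutomorphism) (hw : ∀ j, 0 < w j) (i : Fin 2) :
    F i ≠ 0 ∧ weightedTotalDegree w (F i) ≠ 0 := by
  have h : weightedTotalDegree w (F i) ≠ 0 := by
    intro h
    apply (isUnit_jacobian hF).ne_zero
    have h0 : pderiv 0 (F i) = 0 := pderiv_eq_zero_of_weightedTotalDegree_lt (h ▸ hw 0)
    have h1 : pderiv 1 (F i) = 0 := pderiv_eq_zero_of_weightedTotalDegree_lt (h ▸ hw 1)
    rw [jacobian_apply]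
    fin_cases i <;> simp_all
  exact ⟨fun h0 => h (by rw [h0, weightedTotalDegree_zero]; rfl), h⟩

/-- The Jacobian of the leading forms is the component of weight $d_1+d_2-w_0-w_1$ of a constant, so
it is zero unless that weight is $0$. -/
theorem weightedTotalDegree_add_eq (hF : F.IsAutomorphism)
    (h : jacobian (leadingForm w (F 0)) (leadingForm w (F 1)) ≠ 0) :
    weightedTotalDegree w (F 0) + weightedTotalDegree w (F 1) = w 0 + w 1 := by
  obtain ⟨c, -, hc⟩ := exists_jacobian_eq_C hF
  have e := (weightLE_weightedTotalDegree w (F 0)).weightedHomogeneousComponent_jacobian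
    (weightLE_weightedTotalDegree w (F 1))
  by_contra hne
  apply h
  rw [leadingForm, leadingForm, ← e, hc,
    (isWeightedHomogeneous_C _ c).weightedHomogeneousComponent_ne]
  omega

theorem weightedTotalDegree_dichotomy (hF : F.IsAutomorphism) (hw : ∀ j, 0 < w j) :
    (∃ (k l : ℕ) (i : Fin 2), 0 < k ∧ 0 < l ∧ weightedTotalDegree w (F 0) = k * w i ∧
      weightedTotalDegree w (F 1) = l * w i ∧ (k ∣ l ∨ l ∣ k)) ∨
    weightedTotalDegree w (F 0) + weightedTotalDegree w (F 1) = w 0 + w 1 := by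
  have hD := isLocallyNilpotent_jacobian_leadingForm hF w
  have hn := component_nonconstant hF hw
  have hT : ∀ i, leadingForm w (F i) ≠ 0 := fun i => leadingForm_ne_zero (hn i).1
  have hder : ∀ i j, axis j (leadingForm w (F i)) = 0 → pderiv j (leadingForm w (F i)) = 0 :=
    fun i j => pderiv_eq_zero_of_axis_eq_zero (hD i) (hT i)
  have hex := fun i => exists_pderiv_leadingForm_ne_zero (w := w) (hn i).1 (hn i).2
  by_cases hcase : ∃ j, axis j (leadingForm w (F 0)) ≠ 0 ∧ axis j (leadingForm w (F 1)) ≠ 0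
  · left
    obtain ⟨j, h0, h1⟩ := hcase
    have e0 := weightedTotalDegree_eq_natDegree_axis_mul h0
    have e1 := weightedTotalDegree_eq_natDegree_axis_mul h1
    have n0 : (axis j (F 0)).natDegree ≠ 0 := fun h => (hn 0).2 (by rw [e0, h, zero_mul])
    have n1 : (axis j (F 1)).natDegree ≠ 0 := fun h => (hn 1).2 (by rw [e1, h, zero_mul])
    exact ⟨_, _, j, Nat.pos_of_ne_zero n0, Nat.pos_of_ne_zero n1, e0, e1,
      natDegree_axis_dvd_or_dvd hF j n0 n1⟩
  · right
    push Not at hcase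
    -- No leading form vanishes on both axes, so with no common axis each is a nonconstant
    -- polynomial in one variable, and the two variables differ.
    have hzero : ∀ i, axis 0 (leadingForm w (F i)) = 0 → axis 1 (leadingForm w (F i)) ≠ 0 :=
      fun i h0 h1 => (hex i).elim (· (hder i 0 h0)) (· (hder i 1 h1))
    apply weightedTotalDegree_add_eq hF
    rw [jacobian_apply]
    by_cases h0 : axis 0 (leadingForm w (F 0)) = 0
    · have p0 := hder 0 0 h0
      have p1 := hder 1 1 (hcase 1 (hzero 0 h0))
      have := hex 0
      have := hex 1
      simp_all
    · have h1 := hcase 0 h0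
      have p1 := hder 1 0 h1
      have p0 := hder 0 1 (by
        by_contra h
        exact hzero 1 h1 (hcase 1 h))
      have := hex 0
      have := hex 1
      simp_all

end PolyMap

/-! ### Realising degree pairs by elementary maps -/

namespace MvPolynomial

section

variable {σ R : Type*} [CommRing R] {w : σ → ℤ} {n k : ℤ} {p q : MvPolynomial σ R}

theorem WeightLE.add (hp : WeightLE w n p) (hq : WeightLE w n q) : WeightLE w n (p + q) := by
  have h0 : WeightLE w n (0 : MvPolynomial σ R) := fun m hm => absurd (coeff_zero m) hm
  simpa using hp.sub (h0.sub hq)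

theorem WeightLE.mono (hp : WeightLE w n p) (h : n ≤ k) : WeightLE w k p :=
  fun m hm => (hp m hm).trans h

theorem weightLE_X (i : σ) : WeightLE w (w i) (X i : MvPolynomial σ R) := by
  classical
  intro m hm
  rw [coeff_X, ite_ne_right_iff] at hm
  rw [← hm.1, Finsupp.weight_single, one_smul]

theorem WeightLE.pow (hp : WeightLE w n p) (l : ℕ) : WeightLE w (l * n) (p ^ l) := by
  classical
  induction l with
  | zero =>
    intro m hm
    rw [pow_zero, coeff_one, ite_ne_right_iff] at hm
    simp [← hm.1]
  | succ l ih =>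
    rw [pow_succ]
    convert ih.mul hp using 1
    push_cast
    ring

end

variable {w : Fin 2 → ℕ} {p : MvPolynomial (Fin 2) ℂ} {n : ℕ}

theorem WeightLE.weightedTotalDegree_le (h : WeightLE (fun i => (w i : ℤ)) n p) :
    weightedTotalDegree w p ≤ n := by
  refine Finset.sup_le fun m hm => ?_
  have := h m (mem_support_iff.1 hm)
  rw [weight_natCast] at this
  exact_mod_cast this

theorem le_weightedTotalDegree_of_coeff_axis_ne_zero {i : Fin 2} (h : (axis i p).coeff n ≠ 0) :
    n * w i ≤ weightedTotalDegree w p := by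
  rw [coeff_axis] at h
  have := le_weightedTotalDegree w (mem_support_iff.2 h)
  rwa [Finsupp.weight_single, smul_eq_mul] at this

theorem axis_X_self {R : Type*} [CommRing R] (i : Fin 2) :
    axis i (X i : MvPolynomial (Fin 2) R) = Polynomial.X := by
  simp [axis]

theorem axis_X_of_ne {R : Type*} [CommRing R] {i j : Fin 2} (h : j ≠ i) :
    axis i (X j : MvPolynomial (Fin 2) R) = 0 := by
  simp [axis, h]

theorem weightedTotalDegree_X_eq (w : Fin 2 → ℕ) (i : Fin 2) :
    weightedTotalDegree w (X i : MvPolynomial (Fin 2) ℂ) = w i := by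
  refine le_antisymm (WeightLE.weightedTotalDegree_le (weightLE_X i)) ?_
  simpa using le_weightedTotalDegree_of_coeff_axis_ne_zero (w := w) (p := X i) (n := 1) (i := i)
    (by simp [axis_X_self])

theorem weightLE_X_add_X_pow {i j : Fin 2} {k : ℕ} (h : w j ≤ k * w i) :
    WeightLE (fun i => (w i : ℤ)) (k * w i : ℕ) (X j + X i ^ k : MvPolynomial (Fin 2) ℂ) := by
  refine WeightLE.add ((weightLE_X j).mono (by exact_mod_cast h)) ?_
  convert (weightLE_X (w := fun i => (w i : ℤ)) i).pow k using 1
  push_cast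
  ring

theorem weightedTotalDegree_X_add_X_pow {i j : Fin 2} (hij : i ≠ j) {k : ℕ} (h : w j ≤ k * w i) :
    weightedTotalDegree w (X j + X i ^ k : MvPolynomial (Fin 2) ℂ) = k * w i := by
  refine le_antisymm (weightLE_X_add_X_pow h).weightedTotalDegree_le ?_
  apply le_weightedTotalDegree_of_coeff_axis_ne_zero
  simp [axis_X_self, axis_X_of_ne hij.symm]

theorem weightedTotalDegree_X_add_pow {i j : Fin 2} (hij : i ≠ j) {k l : ℕ} (hk : 0 < k)
    (hl : 0 < l) (h : w j ≤ k * w i) :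
    weightedTotalDegree w (X i + (X j + X i ^ k) ^ l : MvPolynomial (Fin 2) ℂ) =
      k * l * w i := by
  refine le_antisymm (WeightLE.weightedTotalDegree_le ?_) ?_
  · refine WeightLE.add ((weightLE_X i).mono ?_) ?_
    · exact_mod_cast Nat.le_mul_of_pos_left _ (Nat.mul_pos hk hl)
    · convert (weightLE_X_add_X_pow h).pow l using 1
      push_cast
      ring
  · apply le_weightedTotalDegree_of_coeff_axis_ne_zero
    simp only [map_add, map_pow, axis_X_self, axis_X_of_ne hij.symm, zero_add, ← pow_mul,
      Polynomial.coeff_add, Polynomial.coeff_X_pow_self, Polynomial.coeff_X]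
    split_ifs <;> norm_num

end MvPolynomial

namespace PolyMap

open MvPolynomial

theorem IsAutomorphism.swap {F : PolyMap 2} (hF : F.IsAutomorphism) :
    IsAutomorphism ![F 1, F 0] := by
  obtain ⟨G, hFG, hGF⟩ := hF
  refine ⟨fun k => bind₁ ![X 1, X 0] (G k), ?_, ?_⟩
  · funext i
    have h : ∀ i, bind₁ G (F i) = X i := fun i => congrFun hFG i
    have e : ∀ p : MvPolynomial (Fin 2) ℂ, bind₁ (fun k => bind₁ ![X 1, X 0] (G k)) p =
        bind₁ (![X 1, X 0] : PolyMap 2) (bind₁ G p) := fun p => (bind₁_bind₁ _ _ _).symm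
    fin_cases i <;> simp [comp, identity, e, h]
  · funext i
    have e : (fun k => bind₁ (![F 1, F 0] : PolyMap 2) ((![X 1, X 0] : PolyMap 2) k)) = F := by
      funext k
      fin_cases k <;> simp
    change bind₁ (![F 1, F 0] : PolyMap 2) (bind₁ ![X 1, X 0] (G i)) = X i
    rw [bind₁_bind₁, e]
    exact congrFun hGF i

theorem isAutomorphism_identity (n : ℕ) : (identity n).IsAutomorphism :=
  ⟨identity n, by funext i; simp [comp, identity], by funext i; simp [comp, identity]⟩

theorem isAutomorphism_elementary {i j : Fin 2} (hij : i ≠ j) (l : ℕ) :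
    IsAutomorphism ![X i, X j + X i ^ l] := by
  refine ⟨fun a => if a = i then X 0 else X 1 - X 0 ^ l, ?_, ?_⟩
  · funext a
    fin_cases i <;> fin_cases j <;> fin_cases a <;> simp_all [comp, identity]
  · funext a
    fin_cases i <;> fin_cases j <;> fin_cases a <;> simp_all [comp, identity]

theorem isAutomorphism_elementary_comp_elementary {i j : Fin 2} (hij : i ≠ j) (k l : ℕ) :
    IsAutomorphism ![X j + X i ^ k, X i + (X j + X i ^ k) ^ l] := by
  refine ⟨fun a => if a = i then X 1 - X 0 ^ l else X 0 - (X 1 - X 0 ^ l) ^ k, ?_, ?_⟩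
  · funext a
    fin_cases i <;> fin_cases j <;> fin_cases a <;> simp_all [comp, identity]
  · funext a
    fin_cases i <;> fin_cases j <;> fin_cases a <;> simp_all [comp, identity]

theorem exists_isAutomorphism_weightedTotalDegree_of_mul {w : Fin 2 → ℕ} {i j : Fin 2}
    (hij : i ≠ j) {k l : ℕ} (hk : 0 < k) (hl : 0 < l) (hmax : max (w i) (w j) ≤ k * l * w i)
    (hmin : k * w i < max (w i) (w j) → k * w i = min (w i) (w j)) :
    ∃ F : PolyMap 2, F.IsAutomorphism ∧ weightedTotalDegree w (F 0) = k * w i ∧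
      weightedTotalDegree w (F 1) = k * l * w i := by
  by_cases h : w j ≤ k * w i
  · exact ⟨_, isAutomorphism_elementary_comp_elementary hij k l,
      weightedTotalDegree_X_add_X_pow hij h, weightedTotalDegree_X_add_pow hij hk hl h⟩
  -- Here $w_i\le kw_i<w_j$, so `hmin` forces $kw_i=w_i$ and a single elementary map suffices.
  · have h1 : w i ≤ k * w i := Nat.le_mul_of_pos_left _ hk
    have h2 : k * w i = w i := by omega
    have h3 : k * l * w i = l * w i := by rw [mul_right_comm, h2, mul_comm]
    rw [h3] at hmax ⊢
    rw [h2]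
    exact ⟨_, isAutomorphism_elementary hij l, weightedTotalDegree_X_eq w i,
      weightedTotalDegree_X_add_X_pow hij (by omega)⟩

theorem exists_isAutomorphism_weightedTotalDegree {w : Fin 2 → ℕ} {i j : Fin 2}
    (hij : i ≠ j) {d₁ d₂ : ℕ} (h₁ : d₁ ∈ positiveMultiples (w i))
    (h₂ : d₂ ∈ positiveMultiples (w i)) (hw : 0 < w i) (hd : d₁ ∣ d₂ ∨ d₂ ∣ d₁)
    (hmax : max (w i) (w j) ≤ max d₁ d₂)
    (hmin : min d₁ d₂ < max (w i) (w j) → min d₁ d₂ = min (w i) (w j)) :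
    ∃ F : PolyMap 2, F.IsAutomorphism ∧ weightedTotalDegree w (F 0) = d₁ ∧
      weightedTotalDegree w (F 1) = d₂ := by
  wlog h : d₁ ∣ d₂ generalizing d₁ d₂
  · obtain ⟨F, hF, e₁, e₂⟩ := this h₂ h₁ hd.symm (by rwa [max_comm d₂]) (by rwa [min_comm d₂])
      (hd.resolve_left h)
    exact ⟨_, hF.swap, e₂, e₁⟩
  obtain ⟨k, hk, rfl⟩ := h₁
  obtain ⟨l', hl', rfl⟩ := h₂
  obtain ⟨l, rfl⟩ := (Nat.mul_dvd_mul_iff_right hw).1 h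
  have hl : 0 < l := Nat.pos_of_mul_pos_left hl'
  have hle : k * w i ≤ k * l * w i := Nat.mul_le_mul_right _ (Nat.le_mul_of_pos_right _ hl)
  rw [max_eq_right hle] at hmax
  rw [min_eq_left hle] at hmin
  exact exists_isAutomorphism_weightedTotalDegree_of_mul hij hk hl hmax hmin

end PolyMap

/-! ### The set of weighted bidegrees -/

theorem theorem1 (w₁ w₂ : ℕ) (hw₁ : 0 < w₁) (hw₂ : 0 < w₂) :
    PolyMap.weightedBidegree (w₁, w₂) '' PolyMap.aut 2 =
      {d : ℕ × ℕ | (d.1 ∈ positiveMultiples w₁ ∧ d.2 ∈ positiveMultiples w₁) ∧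
          (d.1 ∣ d.2 ∨ d.2 ∣ d.1) ∧ max w₁ w₂ ≤ max d.1 d.2 ∧
          (min d.1 d.2 < max w₁ w₂ → min d.1 d.2 = min w₁ w₂)} ∪
      {d : ℕ × ℕ | (d.1 ∈ positiveMultiples w₂ ∧ d.2 ∈ positiveMultiples w₂) ∧
          (d.1 ∣ d.2 ∨ d.2 ∣ d.1) ∧ max w₁ w₂ ≤ max d.1 d.2 ∧
          (min d.1 d.2 < max w₁ w₂ → min d.1 d.2 = min w₁ w₂)} ∪
      {(w₁, w₂), (w₂, w₁), (max w₁ w₂, max w₁ w₂)} := by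
  have hbi : ∀ F : PolyMap 2, PolyMap.weightedBidegree (w₁, w₂) F =
    (MvPolynomial.weightedTotalDegree ![w₁, w₂] (F 0),
      MvPolynomial.weightedTotalDegree ![w₁, w₂] (F 1)) := fun F => rfl
  apply Set.Subset.antisymm
  · rintro _ ⟨F, hF : F.IsAutomorphism, rfl⟩
    rw [hbi]
    have hmin : ∀ k, MvPolynomial.weightedTotalDegree ![w₁, w₂] (F k) < max w₁ w₂ →
        MvPolynomial.weightedTotalDegree ![w₁, w₂] (F k) = min w₁ w₂ := by
      intro k hk
      have h0 := PolyMap.weightedTotalDegree_eq_of_lt (w := ![w₁, w₂]) hF k zero_ne_one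
      have h1 := PolyMap.weightedTotalDegree_eq_of_lt (w := ![w₁, w₂]) hF k one_ne_zero
      simp only [Matrix.cons_val_zero, Matrix.cons_val_one] at h0 h1
      omega
    have hmax0 := PolyMap.exists_weight_le (w := ![w₁, w₂]) hF 0
    have hmax1 := PolyMap.exists_weight_le (w := ![w₁, w₂]) hF 1
    have hdich := PolyMap.weightedTotalDegree_dichotomy (w := ![w₁, w₂]) hF
      (Fin.forall_fin_two.2 ⟨hw₁, hw₂⟩)
    have hmin0 := hmin 0
    have hmin1 := hmin 1
    simp only [Matrix.cons_val_zero, Matrix.cons_val_one] at hmax0 hmax1 hdich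
    generalize MvPolynomial.weightedTotalDegree ![w₁, w₂] (F 0) = d₁ at *
    generalize MvPolynomial.weightedTotalDegree ![w₁, w₂] (F 1) = d₂ at *
    rcases hdich with ⟨k, l, i, hk, hl, e₁, e₂, hkl⟩ | hsum
    · left
      have hd : d₁ ∣ d₂ ∨ d₂ ∣ d₁ := by
        rw [e₁, e₂]
        exact hkl.imp (Nat.mul_dvd_mul_right · _) (Nat.mul_dvd_mul_right · _)
      have hrest : max w₁ w₂ ≤ max d₁ d₂ ∧ (min d₁ d₂ < max w₁ w₂ → min d₁ d₂ = min w₁ w₂) := by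
        omega
      fin_cases i
      · exact Or.inl ⟨⟨⟨k, hk, e₁⟩, ⟨l, hl, e₂⟩⟩, hd, hrest⟩
      · exact Or.inr ⟨⟨⟨k, hk, e₁⟩, ⟨l, hl, e₂⟩⟩, hd, hrest⟩
    · right
      simp only [Set.mem_insert_iff, Set.mem_singleton_iff, Prod.mk.injEq]
      -- Each degree is either the smaller weight or at least the larger one, so a sum of $w_1+w_2$
      -- leaves only the exceptional pairs.
      omega
  · have key : ∀ d : ℕ × ℕ, (∃ F : PolyMap 2, F.IsAutomorphism ∧
        MvPolynomial.weightedTotalDegree ![w₁, w₂] (F 0) = d.1 ∧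
        MvPolynomial.weightedTotalDegree ![w₁, w₂] (F 1) = d.2) →
        d ∈ PolyMap.weightedBidegree (w₁, w₂) '' PolyMap.aut 2 := by
      rintro d ⟨F, hF, e₁, e₂⟩
      exact ⟨F, hF, by rw [hbi, e₁, e₂]⟩
    rintro d ((⟨⟨h₁, h₂⟩, hd, hmax, hmin⟩ | ⟨⟨h₁, h₂⟩, hd, hmax, hmin⟩) | hd)
    · exact key d (PolyMap.exists_isAutomorphism_weightedTotalDegree (i := 0) (j := 1)
        zero_ne_one h₁ h₂ hw₁ hd hmax hmin)
    · exact key d (PolyMap.exists_isAutomorphism_weightedTotalDegree (i := 1) (j := 0)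
        one_ne_zero h₁ h₂ hw₂ hd (by simpa [max_comm] using hmax)
        (by simpa [max_comm, min_comm] using hmin))
    · have hX := MvPolynomial.weightedTotalDegree_X_eq ![w₁, w₂]
      simp only [Set.mem_insert_iff, Set.mem_singleton_iff] at hd
      rcases hd with rfl | rfl | rfl
      · exact key _ ⟨_, PolyMap.isAutomorphism_identity 2, hX 0, hX 1⟩
      · exact key _ ⟨_, (PolyMap.isAutomorphism_identity 2).swap, hX 1, hX 0⟩
      -- Take $k=l=1$ with `i` an index of the larger weight: both components then contain the
      -- heavier variable linearly.
      · rcases le_total w₁ w₂ with h | h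
        · obtain ⟨F, hF, e₁, e₂⟩ := PolyMap.exists_isAutomorphism_weightedTotalDegree_of_mul
            (w := ![w₁, w₂]) (i := 1) (j := 0) one_ne_zero one_pos one_pos (by simpa using h)
            (by simp [h])
          exact key _ ⟨F, hF, by simpa [h] using e₁, by simpa [h] using e₂⟩
        · obtain ⟨F, hF, e₁, e₂⟩ := PolyMap.exists_isAutomorphism_weightedTotalDegree_of_mul
            (w := ![w₁, w₂]) (i := 0) (j := 1) zero_ne_one one_pos one_pos (by simpa using h)
            (by simp [h])
          exact key _ ⟨F, hF, by simpa [h] using e₁, by simpa [h] using e₂⟩
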